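/- All Hilbert spaces are complex. Let $B$ be a JB$^*$-algebra (for instance a C$^*$-algebra with $x\circ y=\frac12(xy+yx)$), with triple product $\{a,b,c\}=(a\circ b^*)\circ c+(c\circ b^*)\circ a-(a\circ c)\circ b^*$; in a C$^*$-algebra $\{a,b,c\}=\frac12(ab^*c+cb^*a)$. For a norm-one functional $\varphi\in B^*$ put $\|x\|_\varphi=(\varphi\{x,x,z\})^{1/2}$ for $x\in B$, where $z\in B^{**}$ is any element with $\|z\|=1$ and $\varphi(z)=1$, and $\varphi\{x,x,z\}$ denotes the value of $z$ at the functional $c\mapsto\varphi\{x,x,c\}$ of $B^*$ (the result does not depend on the choice of $z$). For a Hilbert space $H$ and $K\in\mathbb R$, say that the little Grothendieck inequality holds for $(B,H)$ with constant $K$ if for every bounded linear operator $T:B\to H$ and every $\varepsilon>0$ there is a norm-one $\varphi\in B^*$ with $\|Tx\|\le(K+\varepsilon)\|T\|\,\|x\|_\varphi$ for all $x\in B$. Let $K(H)$ be the C$^*$-algebra of compact operators on a Hilbert space $H$; for a unit vector $\xi\in H$ let $T_\xi:K(H)\to H$, $T_\xi x=x\xi$. (1) If $H$ is infinite-dimensional,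 then for every unit vector $\xi\in H$ we have $\|T_\xi\|=1$ and, for every norm-one $\varphi\in K(H)^*$, $$\sup\left\{\frac{\|T_\xi x\|}{\|T_\xi\|\,\|x\|_\varphi}:\ x\in K(H),\ \|x\|_\varphi\ne0\right\}\ge\sqrt2 ,$$ where the supremum is taken in $[0,\infty]$. Hence, if the little Grothendieck inequality holds for $(K(H),H)$ with constant $K$, then $K\ge\sqrt2$. (2) Consequently, if the little Grothendieck inequality holds with the same constant $K$ for all nonzero JB$^*$-algebras $B$ and all Hilbert spaces $H$, then $K\ge\sqrt2$. (3) If $H$ has finite dimension $n\ge1$ (so that $K(H)=B(H)$ is the algebra of $n\times n$ matrices), then the statements of (1) hold with $\sqrt2$ replaced by $\sqrt{\frac{2n}{n+2}}$. -/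

import Mathlib

universe u

noncomputable section

/-- A JB*-algebra: a complex Banach space with a commutative bilinear product `x ∘ y` satisfying
the Jordan identity and a conjugate-linear involution compatible with the product, such that
`‖x ∘ y‖ ≤ ‖x‖ ‖y‖` and `‖U_x (x*)‖ = ‖x‖³`, where `U_x y = 2 (x ∘ y) ∘ x - (x ∘ x) ∘ y`. -/
class JBStarAlgebra (B : Type*) [NormedAddCommGroup B] [NormedSpace ℂ B] where
  complete : CompleteSpace B
  jmul : B →ₗ[ℂ] B →ₗ[ℂ] B
  jstar : B → B
  jmul_comm : ∀ x y, jmul x y = jmul y x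
  jordan_identity : ∀ x y, jmul (jmul x y) (jmul x x) = jmul x (jmul y (jmul x x))
  jstar_add : ∀ x y, jstar (x + y) = jstar x + jstar y
  jstar_smul : ∀ (c : ℂ) (x : B), jstar (c • x) = (starRingEnd ℂ c) • jstar x
  jstar_jstar : ∀ x, jstar (jstar x) = x
  jstar_jmul : ∀ x y, jstar (jmul x y) = jmul (jstar y) (jstar x)
  norm_jmul_le : ∀ x y, ‖jmul x y‖ ≤ ‖x‖ * ‖y‖
  norm_U_jstar : ∀ x,
    ‖(2 : ℂ) • jmul (jmul x (jstar x)) x - jmul (jmul x x) (jstar x)‖ = ‖x‖ ^ 3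

namespace JBStarAlgebra

section

variable {B : Type*} [NormedAddCommGroup B] [NormedSpace ℂ B] [JBStarAlgebra B]

/-- The bounded operator `y ↦ x ∘ y`. -/
def mulCLM (x : B) : B →L[ℂ] B :=
  (jmul x).mkContinuous ‖x‖ (norm_jmul_le x)

/-- The bounded operator `L(x, y) : c ↦ {x, y, c}`, where the triple product of a JB*-algebra is
`{x, y, c} = (x ∘ y*) ∘ c + (c ∘ y*) ∘ x - (x ∘ c) ∘ y*`. -/
def tripleCLM (x y : B) : B →L[ℂ] B :=
  mulCLM (jmul x (jstar y)) + (mulCLM x).comp (mulCLM (jstar y))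
    - (mulCLM (jstar y)).comp (mulCLM x)

theorem tripleCLM_apply (x y c : B) :
    tripleCLM x y c = jmul (jmul x (jstar y)) c + jmul (jmul c (jstar y)) x
      - jmul (jmul x c) (jstar y) := by
  have h1 : jmul x (jmul (jstar y) c) = jmul (jmul c (jstar y)) x := by
    rw [jmul_comm x, jmul_comm (jstar y) c]
  have h2 : jmul (jstar y) (jmul x c) = jmul (jmul x c) (jstar y) := jmul_comm _ _
  simp [tripleCLM, mulCLM, h1, h2]

/-- `z ∈ B**` is a norm-one element at which `φ ∈ B*`, seen as an element of the predual of `B**`,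
attains its norm. -/
def IsNormingFor (φ : StrongDual ℂ B) (z : StrongDual ℂ (StrongDual ℂ B)) : Prop :=
  ‖z‖ = 1 ∧ z φ = (‖φ‖ : ℂ)

/-- The prehilbertian seminorm `‖x‖_φ = (φ {x, x, z})^{1/2}` on `B`, computed with an element
`z ∈ B**` norming `φ`. On `B**` the map `z ↦ {x, x, z}` is the weak*-continuous extension
`L(x, x)**` of `L(x, x)`, so that `φ {x, x, z}` is the value of `z` at the functional
`c ↦ φ {x, x, c}` of `B*`. (The number `φ {x, x, z}` is real, nonnegative and the same for all
norming `z`.) -/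
def seminormAt (φ : StrongDual ℂ B) (z : StrongDual ℂ (StrongDual ℂ B)) (x : B) : ℝ :=
  Real.sqrt (z (φ.comp (tripleCLM x x))).re

/-- The supremum in `[0, ∞]` of the quotients `‖T x‖ / (‖T‖ ‖x‖_φ)` over all `x` with
`‖x‖_φ ≠ 0`. -/
def ratioSup {H : Type*} [NormedAddCommGroup H] [InnerProductSpace ℂ H] (T : B →L[ℂ] H)
    (φ : StrongDual ℂ B) (z : StrongDual ℂ (StrongDual ℂ B)) : ENNReal :=
  ⨆ (x : B) (_ : seminormAt φ z x ≠ 0), ENNReal.ofReal (‖T x‖ / (‖T‖ * seminormAt φ z x))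

end

theorem exists_isNormingFor {B : Type*} [NormedAddCommGroup B] [NormedSpace ℂ B]
    (φ : StrongDual ℂ B) (hφ : φ ≠ 0) : ∃ z, IsNormingFor φ z :=
  exists_dual_vector ℂ φ (norm_ne_zero_iff.2 hφ)

/-- The little Grothendieck inequality for operators from `B` to `H` holds with the (asymptotic)
constant `K`: for each bounded operator `T : B → H` and each `ε > 0` there is a norm-one
functional `φ` on `B` with `‖T x‖ ≤ (K + ε) ‖T‖ ‖x‖_φ` for all `x`. -/
def LittleGrothendieck (B : Type*) [NormedAddCommGroup B] [NormedSpace ℂ B] [JBStarAlgebra B]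
    (H : Type*) [NormedAddCommGroup H] [InnerProductSpace ℂ H] (K : ℝ) : Prop :=
  ∀ (T : B →L[ℂ] H) (ε : ℝ), 0 < ε →
    ∃ (φ : StrongDual ℂ B) (z : StrongDual ℂ (StrongDual ℂ B)),
      ‖φ‖ = 1 ∧ IsNormingFor φ z ∧ ∀ x : B, ‖T x‖ ≤ (K + ε) * ‖T‖ * seminormAt φ z x

/-- The little Grothendieck inequality holds with the (asymptotic) constant `K` for all nonzero
JB*-algebras and all Hilbert spaces. (The zero algebra has no norm-one functional.) -/
def IsLittleGrothendieckConstant (K : ℝ) : Prop :=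
  ∀ (B : Type u) [NormedAddCommGroup B] [NormedSpace ℂ B] [JBStarAlgebra B] [Nontrivial B]
    (H : Type u) [NormedAddCommGroup H] [InnerProductSpace ℂ H] [CompleteSpace H],
    LittleGrothendieck B H K

/-- Every C*-algebra is a JB*-algebra with the Jordan product `x ∘ y = (xy + yx) / 2`. -/
instance ofCStarAlgebra (A : Type*) [NonUnitalCStarAlgebra A] : JBStarAlgebra A where
  complete := inferInstance
  jmul := (2⁻¹ : ℂ) • (LinearMap.mul ℂ A + (LinearMap.mul ℂ A).flip)
  jstar := star
  jmul_comm x y := by simp [add_comm]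
  jordan_identity x y := by
    simp only [LinearMap.smul_apply, LinearMap.add_apply, LinearMap.mul_apply',
      LinearMap.flip_apply, mul_add, add_mul, smul_add, smul_mul_assoc, mul_smul_comm, mul_assoc]
    abel
  jstar_add := star_add
  jstar_smul c x := by simp
  jstar_jstar := star_star
  jstar_jmul x y := by simp [add_comm]
  norm_jmul_le x y := by
    have h : ‖x * y + y * x‖ ≤ 2 * (‖x‖ * ‖y‖) := by
      calc ‖x * y + y * x‖ ≤ ‖x * y‖ + ‖y * x‖ := norm_add_le _ _
        _ ≤ ‖x‖ * ‖y‖ + ‖y‖ * ‖x‖ := add_le_add (norm_mul_le _ _) (norm_mul_le _ _)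
        _ = 2 * (‖x‖ * ‖y‖) := by ring
    simp only [LinearMap.smul_apply, LinearMap.add_apply, LinearMap.mul_apply',
      LinearMap.flip_apply, norm_smul, norm_inv, RCLike.norm_ofNat]
    linarith
  norm_U_jstar x := by
    have h : (2 : ℂ) • (((2⁻¹ : ℂ) • (LinearMap.mul ℂ A + (LinearMap.mul ℂ A).flip))
          (((2⁻¹ : ℂ) • (LinearMap.mul ℂ A + (LinearMap.mul ℂ A).flip)) x (star x)) x)
        - ((2⁻¹ : ℂ) • (LinearMap.mul ℂ A + (LinearMap.mul ℂ A).flip))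
          (((2⁻¹ : ℂ) • (LinearMap.mul ℂ A + (LinearMap.mul ℂ A).flip)) x x) (star x)
        = x * star x * x := by
      simp only [LinearMap.smul_apply, LinearMap.add_apply, LinearMap.mul_apply',
        LinearMap.flip_apply, mul_add, add_mul, smul_add, smul_mul_assoc, mul_smul_comm,
        mul_assoc]
      module
    rw [h]
    refine le_antisymm ?_ ?_
    · calc ‖x * star x * x‖ ≤ ‖x‖ * ‖star x‖ * ‖x‖ :=
            (norm_mul_le _ _).trans (mul_le_mul_of_nonneg_right (norm_mul_le _ _) (norm_nonneg _))
        _ = ‖x‖ ^ 3 := by rw [norm_star]; ring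
    · rcases (norm_nonneg x).eq_or_lt with h0 | h0
      · rw [← h0]; simp
      · have e : ‖x‖ ^ 4 = ‖x * star x * x * star x‖ := by
          have h1 : x * star x * x * star x = x * star x * star (x * star x) := by
            simp [mul_assoc]
          rw [h1, CStarRing.norm_self_mul_star, CStarRing.norm_self_mul_star]; ring
        have h2 : ‖x‖ ^ 4 ≤ ‖x * star x * x‖ * ‖x‖ := by
          rw [e]; exact (norm_mul_le _ _).trans (by rw [norm_star])
        exact le_of_mul_le_mul_right (by linarith [pow_succ ‖x‖ 3]) h0

theorem tripleCLM_cstar {A : Type*} [NonUnitalCStarAlgebra A] (x y c : A) :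
    tripleCLM x y c = (2⁻¹ : ℂ) • (x * star y * c + c * star y * x) := by
  rw [tripleCLM_apply]
  simp only [jmul, jstar, LinearMap.smul_apply, LinearMap.add_apply, LinearMap.mul_apply',
    LinearMap.flip_apply, mul_add, add_mul, smul_add, smul_mul_assoc, mul_smul_comm, mul_assoc]
  module

end JBStarAlgebra

section CompactOperators

variable (H : Type*) [NormedAddCommGroup H] [InnerProductSpace ℂ H] [CompleteSpace H]

variable {H} in
theorem IsCompactOperator.star_clm {x : H →L[ℂ] H} (hx : IsCompactOperator x) :
    IsCompactOperator (star x : H →L[ℂ] H) := by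
  have hc : IsCompactOperator (x ∘L star x) := hx.comp_clm (star x)
  have htb : TotallyBounded ((x ∘L star x) '' Metric.closedBall 0 1) :=
    (hc.isCompact_closure_image_closedBall 1).totallyBounded.subset subset_closure
  refine (isCompactOperator_iff_isCompact_closure_image_closedBall
    ((star x : H →L[ℂ] H) : H →ₗ[ℂ] H) one_pos).2 ?_
  refine TotallyBounded.isCompact_of_isClosed (TotallyBounded.closure ?_) isClosed_closure
  rw [Metric.totallyBounded_iff]
  intro ε hε
  obtain ⟨t, hts, htf, ht⟩ := Metric.finite_approx_of_totallyBounded htb (ε ^ 2 / 2) (by positivity)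
  obtain ⟨s, hs, hsf, rfl⟩ := (Set.exists_subset_image_finite_and
    (p := fun u => u = t)).1 ⟨t, hts, htf, rfl⟩
  refine ⟨(star x : H →L[ℂ] H) '' s, hsf.image _, ?_⟩
  rintro _ ⟨y, hy, rfl⟩
  have := ht ⟨y, hy, rfl⟩
  simp only [Set.mem_iUnion, Set.mem_image, exists_prop, exists_exists_and_eq_and] at this ⊢
  obtain ⟨w, hw, hyw⟩ := this
  refine ⟨w, hw, ?_⟩
  have hw1 := hs hw
  rw [mem_closedBall_zero_iff] at hy hw1
  rw [Metric.mem_ball, dist_eq_norm] at hyw ⊢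
  have hxy : x (star x (y - w)) = (x ∘L star x) y - (x ∘L star x) w := by simp
  have h2 : ‖star x (y - w)‖ ^ 2 ≤ ‖x (star x (y - w))‖ * ‖y - w‖ := by
    rw [← inner_self_eq_norm_sq (𝕜 := ℂ)]
    conv_lhs => rw [ContinuousLinearMap.star_eq_adjoint, ContinuousLinearMap.adjoint_inner_right]
    exact (RCLike.re_le_norm _).trans (norm_inner_le_norm _ _)
  have h3 : ‖y - w‖ ≤ 2 := (norm_sub_le _ _).trans (by linarith)
  have h4 : ‖star x (y - w)‖ ^ 2 < ε ^ 2 := by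
    rw [hxy] at h2
    nlinarith [norm_nonneg ((x ∘L star x) y - (x ∘L star x) w), norm_nonneg (y - w)]
  have h5 := lt_of_pow_lt_pow_left₀ 2 hε.le h4
  simpa using h5

/-- The C*-algebra `K(H)` of compact operators on the Hilbert space `H`. -/
def compactOps : NonUnitalStarSubalgebra ℂ (H →L[ℂ] H) where
  carrier := {x | IsCompactOperator x}
  add_mem' hx hy := hx.add hy
  zero_mem' := isCompactOperator_zero
  mul_mem' {_ y} hx _ := hx.comp_clm y
  smul_mem' c _ hx := hx.smul c
  star_mem' hx := hx.star_clm

instance compactOps_isClosed : IsClosed (compactOps H : Set (H →L[ℂ] H)) :=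
  isClosed_setOfPred_isCompactOperator

instance : NonUnitalCStarAlgebra (compactOps H) :=
  NonUnitalStarSubalgebra.nonUnitalCStarAlgebra (compactOps H)

variable {H}

/-- The operator `T : K(H) → H`, `T x = x ξ`. -/
def evalAt (ξ : H) : compactOps H →L[ℂ] H :=
  LinearMap.mkContinuous
    { toFun := fun x => (x : H →L[ℂ] H) ξ
      map_add' := fun _ _ => rfl
      map_smul' := fun _ _ => rfl } ‖ξ‖
    (fun x => by
      rw [mul_comm]
      exact (x : H →L[ℂ] H).le_opNorm ξ)

end CompactOperators

end

/-! For a norm-one `φ` on `K(H)` and a norming `z` in the bidual, `a ↦ φ(az)` and `a ↦ φ(za)` are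
contractive unital functionals on `B(H)`, hence positive, and `‖x‖_φ²` is the mean of the first at
`x x*` and the second at `x* x`. Take `x = η ⊗ ξ` with unit vectors: then `T_ξ x = η` has norm one,
while `x x* = η ⊗ η` and `x* x = ξ ⊗ ξ`. The second term is at most 1. The first, summed over an
orthonormal basis of an `N`-dimensional subspace, gives at most 1, so some `η` contributes at most
`1/N`. Hence the squared ratio is at least `2N/(N+1)`; this is `exists_quadForm_rankOne_le` and
`ofReal_sqrt_le_ratioSup_of_finrank`.

The supremum ignores `x` with `‖x‖_φ = 0`. If `η ⊗ ξ` is such an `x`, it is perturbed by a small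
operator of positive seminorm. That one exists (`exists_quadForm_pos`) because `φ` is partly
concentrated on a finite-dimensional subspace. -/

section CStar

/-! ### Positivity of contractive unital functionals -/

variable {A : Type*} [CStarAlgebra A]

/-- A contractive unital functional on a C*-algebra is nonnegative at `a * star a`. -/
theorem CStarAlgebra.re_apply_mul_star_self_nonneg {f : A →ₗ[ℂ] ℂ} (hf : ∀ a, ‖f a‖ ≤ ‖a‖)
    (hf1 : f 1 = 1) (a : A) : 0 ≤ (f (a * star a)).re := by
  let _ := CStarAlgebra.spectralOrder A
  have _ := CStarAlgebra.spectralOrderedRing A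
  -- Since `0 ≤ a a* ≤ ‖a‖²`, the difference `‖a‖² - a a*` has norm at most `‖a‖²`; contractivity
  -- then forces `‖a‖² - Re f(a a*) ≤ ‖a‖²`.
  have h1 : a * star a ≤ algebraMap ℝ A (‖a‖ ^ 2) := CStarAlgebra.mul_star_le_algebraMap_norm_sq
  have h2 : ‖algebraMap ℝ A (‖a‖ ^ 2) - a * star a‖ ≤ ‖a‖ ^ 2 := by
    refine (CStarAlgebra.norm_le_norm_of_nonneg_of_le (sub_nonneg.2 h1)
      (sub_le_self _ (mul_star_self_nonneg a))).trans ?_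
    rw [norm_algebraMap]
    rcases subsingleton_or_nontrivial A with h | h
    · simp [Subsingleton.elim a 0]
    · simp
  have h3 : f (algebraMap ℝ A (‖a‖ ^ 2) - a * star a) = ((‖a‖ ^ 2 : ℝ) : ℂ) - f (a * star a) := by
    have h : algebraMap ℝ A (‖a‖ ^ 2) = ((‖a‖ ^ 2 : ℝ) : ℂ) • (1 : A) := by
      rw [Algebra.algebraMap_eq_smul_one, Complex.coe_smul]
    rw [map_sub, h, map_smul, hf1, smul_eq_mul, mul_one]
  have h4 := (Complex.re_le_norm _).trans ((hf _).trans h2)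
  rw [h3, Complex.sub_re, Complex.ofReal_re] at h4
  linarith

theorem CStarAlgebra.re_apply_star_mul_self_nonneg {f : A →ₗ[ℂ] ℂ} (hf : ∀ a, ‖f a‖ ≤ ‖a‖)
    (hf1 : f 1 = 1) (a : A) : 0 ≤ (f (star a * a)).re := by
  simpa using CStarAlgebra.re_apply_mul_star_self_nonneg hf hf1 (star a)

end CStar

/-! ### Multiplication by bounded operators and the two functionals on `B(H)` -/

section

variable {H : Type*} [NormedAddCommGroup H] [InnerProductSpace ℂ H] [CompleteSpace H]

theorem IsCompactOperator.of_finiteDimensional_mem {H : Type*} [NormedAddCommGroup H]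
    [InnerProductSpace ℂ H] {x : H →L[ℂ] H} (U : Submodule ℂ H)
    [FiniteDimensional ℂ U] (hx : ∀ v, x v ∈ U) : IsCompactOperator x := by
  have h : IsCompactOperator (U.subtypeL : U → H) :=
    ⟨_, (isCompact_closedBall (0 : U) 1).image U.subtypeL.continuous,
      Filter.mem_of_superset (Metric.closedBall_mem_nhds 0 one_pos) (Set.subset_preimage_image _ _)⟩
  exact h.comp_clm (x.codRestrict U hx)

namespace compactOps

/-- The action of a bounded operator on the compact operators by left multiplication. -/
noncomputable def leftMul (a : H →L[ℂ] H) : compactOps H →L[ℂ] compactOps H :=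
  LinearMap.mkContinuous
    { toFun := fun x => ⟨a * x, IsCompactOperator.clm_comp x.2 a⟩
      map_add' := fun x y => Subtype.ext (mul_add a (x : H →L[ℂ] H) y)
      map_smul' := fun c x => Subtype.ext (mul_smul_comm c a (x : H →L[ℂ] H)) } ‖a‖
    (fun x => norm_mul_le a (x : H →L[ℂ] H))

/-- The action of a bounded operator on the compact operators by right multiplication. -/
noncomputable def rightMul (a : H →L[ℂ] H) : compactOps H →L[ℂ] compactOps H :=
  LinearMap.mkContinuous
    { toFun := fun x => ⟨x * a, IsCompactOperator.comp_clm x.2 a⟩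
      map_add' := fun x y => Subtype.ext (add_mul (x : H →L[ℂ] H) y a)
      map_smul' := fun c x => Subtype.ext (smul_mul_assoc c (x : H →L[ℂ] H) a) } ‖a‖
    (fun x => (norm_mul_le (x : H →L[ℂ] H) a).trans_eq (mul_comm _ _))

@[simp]
theorem coe_leftMul (a : H →L[ℂ] H) (x : compactOps H) : (leftMul a x : H →L[ℂ] H) = a * x := rfl

@[simp]
theorem coe_rightMul (a : H →L[ℂ] H) (x : compactOps H) : (rightMul a x : H →L[ℂ] H) = x * a := rfl

theorem norm_leftMul_le (a : H →L[ℂ] H) : ‖leftMul a‖ ≤ ‖a‖ :=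
  LinearMap.mkContinuous_norm_le _ (norm_nonneg a) _

theorem norm_rightMul_le (a : H →L[ℂ] H) : ‖rightMul a‖ ≤ ‖a‖ :=
  LinearMap.mkContinuous_norm_le _ (norm_nonneg a) _

variable (φ : StrongDual ℂ (compactOps H)) (z : StrongDual ℂ (StrongDual ℂ (compactOps H)))

/-- The functional `a ↦ φ (a z)` on `B(H)`, for `φ ∈ K(H)*` and `z ∈ K(H)**`. -/
noncomputable def leftFunctional : (H →L[ℂ] H) →ₗ[ℂ] ℂ where
  toFun a := z (φ.comp (leftMul a))
  map_add' a b := by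
    rw [← map_add]
    congr 1
    ext x
    rw [add_apply, ContinuousLinearMap.comp_apply,
      ContinuousLinearMap.comp_apply, ContinuousLinearMap.comp_apply, ← map_add]
    exact congrArg φ (Subtype.ext (add_mul a b (x : H →L[ℂ] H)))
  map_smul' c a := by
    rw [RingHom.id_apply, ← map_smul]
    congr 1
    ext x
    rw [smul_apply, ContinuousLinearMap.comp_apply,
      ContinuousLinearMap.comp_apply, ← map_smul]
    exact congrArg φ (Subtype.ext (smul_mul_assoc c a (x : H →L[ℂ] H)))

/-- The functional `a ↦ φ (z a)` on `B(H)`, for `φ ∈ K(H)*` and `z ∈ K(H)**`. -/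
noncomputable def rightFunctional : (H →L[ℂ] H) →ₗ[ℂ] ℂ where
  toFun a := z (φ.comp (rightMul a))
  map_add' a b := by
    rw [← map_add]
    congr 1
    ext x
    rw [add_apply, ContinuousLinearMap.comp_apply,
      ContinuousLinearMap.comp_apply, ContinuousLinearMap.comp_apply, ← map_add]
    exact congrArg φ (Subtype.ext (mul_add (x : H →L[ℂ] H) a b))
  map_smul' c a := by
    rw [RingHom.id_apply, ← map_smul]
    congr 1
    ext x
    rw [smul_apply, ContinuousLinearMap.comp_apply,
      ContinuousLinearMap.comp_apply, ← map_smul]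
    exact congrArg φ (Subtype.ext (mul_smul_comm c (x : H →L[ℂ] H) a))

theorem leftFunctional_apply (a : H →L[ℂ] H) :
    leftFunctional φ z a = z (φ.comp (leftMul a)) := rfl

theorem rightFunctional_apply (a : H →L[ℂ] H) :
    rightFunctional φ z a = z (φ.comp (rightMul a)) := rfl

variable {φ z}

theorem leftFunctional_one (hz : z φ = 1) : leftFunctional φ z 1 = 1 := by
  rw [leftFunctional_apply, ← hz]
  exact congrArg z (ContinuousLinearMap.ext fun x =>
    congrArg φ (Subtype.ext (one_mul (x : H →L[ℂ] H))))

theorem rightFunctional_one (hz : z φ = 1) : rightFunctional φ z 1 = 1 := by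
  rw [rightFunctional_apply, ← hz]
  exact congrArg z (ContinuousLinearMap.ext fun x =>
    congrArg φ (Subtype.ext (mul_one (x : H →L[ℂ] H))))

theorem norm_leftFunctional_le (hφ : ‖φ‖ = 1) (hz : ‖z‖ = 1) (a : H →L[ℂ] H) :
    ‖leftFunctional φ z a‖ ≤ ‖a‖ :=
  calc ‖leftFunctional φ z a‖ ≤ ‖z‖ * ‖φ.comp (leftMul a)‖ := z.le_opNorm _
    _ ≤ 1 * (1 * ‖a‖) := by
      rw [hz]
      gcongr
      refine (φ.opNorm_comp_le _).trans ?_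
      rw [hφ]
      gcongr
      exact norm_leftMul_le a
    _ = ‖a‖ := by ring

theorem norm_rightFunctional_le (hφ : ‖φ‖ = 1) (hz : ‖z‖ = 1) (a : H →L[ℂ] H) :
    ‖rightFunctional φ z a‖ ≤ ‖a‖ :=
  calc ‖rightFunctional φ z a‖ ≤ ‖z‖ * ‖φ.comp (rightMul a)‖ := z.le_opNorm _
    _ ≤ 1 * (1 * ‖a‖) := by
      rw [hz]
      gcongr
      refine (φ.opNorm_comp_le _).trans ?_
      rw [hφ]
      gcongr
      exact norm_rightMul_le a
    _ = ‖a‖ := by ring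

theorem re_leftFunctional_mul_star_self_nonneg (hφ : ‖φ‖ = 1) (hz : ‖z‖ = 1) (hzφ : z φ = 1)
    (a : H →L[ℂ] H) : 0 ≤ (leftFunctional φ z (a * star a)).re :=
  CStarAlgebra.re_apply_mul_star_self_nonneg (A := H →L[ℂ] H) (f := leftFunctional φ z)
    (norm_leftFunctional_le hφ hz) (leftFunctional_one hzφ) a

theorem re_rightFunctional_star_mul_self_nonneg (hφ : ‖φ‖ = 1) (hz : ‖z‖ = 1) (hzφ : z φ = 1)
    (a : H →L[ℂ] H) : 0 ≤ (rightFunctional φ z (star a * a)).re :=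
  CStarAlgebra.re_apply_star_mul_self_nonneg (A := H →L[ℂ] H) (f := rightFunctional φ z)
    (norm_rightFunctional_le hφ hz) (rightFunctional_one hzφ) a

/-! ### The quadratic form `‖x‖_φ²` -/

variable (φ z)

/-- The quadratic form `x ↦ Re φ {x, x, z}` on `K(H)`. -/
noncomputable def quadForm (x : compactOps H) : ℝ :=
  (z (φ.comp (JBStarAlgebra.tripleCLM x x))).re

/-- The map `c ↦ {x, x, c}` is the mean of left multiplication by `x x*` and right multiplication by
`x* x`. -/
theorem quadForm_eq (x : compactOps H) :
    quadForm φ z x = ((leftFunctional φ z ((x : H →L[ℂ] H) * star (x : H →L[ℂ] H))).re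
      + (rightFunctional φ z (star (x : H →L[ℂ] H) * (x : H →L[ℂ] H))).re) / 2 := by
  have h : φ.comp (JBStarAlgebra.tripleCLM x x)
      = (2⁻¹ : ℂ) • (φ.comp (leftMul ((x : H →L[ℂ] H) * star (x : H →L[ℂ] H)))
        + φ.comp (rightMul (star (x : H →L[ℂ] H) * (x : H →L[ℂ] H)))) := by
    ext c
    rw [smul_apply, add_apply,
      ContinuousLinearMap.comp_apply, ContinuousLinearMap.comp_apply,
      ContinuousLinearMap.comp_apply, JBStarAlgebra.tripleCLM_cstar, ← map_add, ← map_smul]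
    refine congrArg φ (Subtype.ext ?_)
    simp [mul_assoc]
  rw [quadForm, h, map_smul, map_add, leftFunctional_apply, rightFunctional_apply]
  simp [Complex.mul_re]
  ring

theorem quadForm_add_add_quadForm_sub (x y : compactOps H) :
    quadForm φ z (x + y) + quadForm φ z (x - y) = 2 * quadForm φ z x + 2 * quadForm φ z y := by
  have hL : ∀ f : (H →L[ℂ] H) →ₗ[ℂ] ℂ, ∀ a b : H →L[ℂ] H,
      (f ((a + b) * star (a + b))).re + (f ((a - b) * star (a - b))).re
        = 2 * (f (a * star a)).re + 2 * (f (b * star b)).re := by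
    intro f a b
    simp only [star_add, star_sub, mul_add, add_mul, mul_sub, sub_mul, map_add, map_sub,
      Complex.add_re, Complex.sub_re]
    ring
  have h1 := hL (leftFunctional φ z) x y
  -- The right term involves `x* x`, so the identity is applied to the adjoints.
  have h2 := hL (rightFunctional φ z) (star (x : H →L[ℂ] H)) (star (y : H →L[ℂ] H))
  simp only [← star_add, ← star_sub, star_star] at h2
  simp only [quadForm_eq]
  push_cast
  linarith

theorem quadForm_smul (t : ℝ) (x : compactOps H) :
    quadForm φ z ((t : ℂ) • x) = t ^ 2 * quadForm φ z x := by
  simp only [quadForm_eq]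
  have h : (((t : ℂ) • x : compactOps H) : H →L[ℂ] H) = (t : ℂ) • (x : H →L[ℂ] H) := rfl
  rw [h]
  simp only [star_smul, smul_mul_smul_comm, map_smul, smul_eq_mul, RCLike.star_def,
    Complex.conj_ofReal, ← Complex.ofReal_mul, Complex.re_ofReal_mul]
  ring

variable {φ z}

theorem quadForm_nonneg (hφ : ‖φ‖ = 1) (hz : ‖z‖ = 1) (hzφ : z φ = 1) (x : compactOps H) :
    0 ≤ quadForm φ z x := by
  rw [quadForm_eq]
  have h1 := re_leftFunctional_mul_star_self_nonneg hφ hz hzφ (x : H →L[ℂ] H)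
  have h2 := re_rightFunctional_star_mul_self_nonneg hφ hz hzφ (x : H →L[ℂ] H)
  linarith

theorem quadForm_le (hφ : ‖φ‖ = 1) (hz : ‖z‖ = 1) (x : compactOps H) :
    quadForm φ z x ≤ ‖(x : H →L[ℂ] H)‖ ^ 2 := by
  rw [quadForm_eq]
  have h1 := (Complex.re_le_norm _).trans
    (norm_leftFunctional_le hφ hz ((x : H →L[ℂ] H) * star (x : H →L[ℂ] H)))
  have h2 := (Complex.re_le_norm _).trans
    (norm_rightFunctional_le hφ hz (star (x : H →L[ℂ] H) * (x : H →L[ℂ] H)))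
  rw [CStarRing.norm_self_mul_star] at h1
  rw [CStarRing.norm_star_mul_self] at h2
  nlinarith

/-! ### Concentration on finite-dimensional subspaces -/

/-- The orthogonal projection onto a finite-dimensional subspace, as a compact operator. -/
noncomputable def proj (U : Submodule ℂ H) [FiniteDimensional ℂ U] : compactOps H :=
  ⟨U.starProjection, IsCompactOperator.of_finiteDimensional_mem U
    fun v => Submodule.starProjection_apply_mem U v⟩

/-- The operator `v ↦ ⟪ξ, v⟫ η`, as a compact operator. -/
noncomputable def rankOne (η ξ : H) : compactOps H :=
  ⟨InnerProductSpace.rankOne ℂ η ξ, IsCompactOperator.of_finiteDimensional_mem (ℂ ∙ η)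
    fun _ => Submodule.smul_mem _ _ (Submodule.mem_span_singleton_self η)⟩

/-- A compact operator is almost supported, on the range side, in a finite-dimensional subspace. -/
theorem exists_norm_sub_starProjection_mul_le (a : compactOps H) {δ : ℝ} (hδ : 0 < δ) :
    ∃ (U : Submodule ℂ H) (_ : FiniteDimensional ℂ U),
      ‖(a : H →L[ℂ] H) - U.starProjection * (a : H →L[ℂ] H)‖ ≤ δ := by
  have htb : TotallyBounded ((a : H →L[ℂ] H) '' Metric.closedBall 0 1) :=
    (IsCompactOperator.isCompact_closure_image_closedBall (f := ((a : H →L[ℂ] H) : H →ₗ[ℂ] H))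
      a.2 1).totallyBounded.subset subset_closure
  obtain ⟨t, htf, ht⟩ := Metric.totallyBounded_iff.1 htb δ hδ
  refine ⟨Submodule.span ℂ t, FiniteDimensional.span_of_finite ℂ htf, ?_⟩
  have := FiniteDimensional.span_of_finite ℂ htf
  refine ContinuousLinearMap.opNorm_le_of_unit_norm (𝕜 := ℂ) hδ.le fun v hv => ?_
  have hmem := ht ⟨v, by simp [hv], rfl⟩
  simp only [Set.mem_iUnion, exists_prop] at hmem
  obtain ⟨w, hw, hvw⟩ := hmem
  rw [Metric.mem_ball, dist_eq_norm] at hvw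
  -- `U` is spanned by a finite `δ`-net of the image of the unit ball, and the projection of `a v`
  -- is at least as close to `a v` as any net point.
  have := Submodule.starProjection_minimal (U := Submodule.span ℂ t) ((a : H →L[ℂ] H) v)
  calc ‖(a : H →L[ℂ] H) v - (Submodule.span ℂ t).starProjection ((a : H →L[ℂ] H) v)‖
      ≤ ‖(a : H →L[ℂ] H) v - w‖ := by
        rw [this]
        exact ciInf_le ⟨0, by rintro _ ⟨y, rfl⟩; positivity⟩
          (⟨w, Submodule.subset_span hw⟩ : Submodule.span ℂ t)
    _ ≤ δ := hvw.le

/-- The two summands have orthogonal ranges, so Pythagoras applies at each vector. -/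
theorem norm_starProjection_mul_add_sq_le {H : Type*} [NormedAddCommGroup H]
    [InnerProductSpace ℂ H] (U : Submodule ℂ H) [FiniteDimensional ℂ U]
    (a b : H →L[ℂ] H) :
    ‖U.starProjection * a + (1 - U.starProjection) * b‖ ^ 2 ≤ ‖a‖ ^ 2 + ‖b‖ ^ 2 := by
  have h : ‖U.starProjection * a + (1 - U.starProjection) * b‖ ≤ √(‖a‖ ^ 2 + ‖b‖ ^ 2) := by
    refine ContinuousLinearMap.opNorm_le_of_unit_norm (𝕜 := ℂ) (Real.sqrt_nonneg _) fun v hv => ?_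
    refine Real.le_sqrt_of_sq_le ?_
    have e : (U.starProjection * a + (1 - U.starProjection) * b) v
        = U.starProjection (a v) + Uᗮ.starProjection (b v) := by
      simp [Submodule.starProjection_orthogonal]
    have ho : inner ℂ (U.starProjection (a v)) (Uᗮ.starProjection (b v)) = 0 :=
      Submodule.inner_right_of_mem_orthogonal (Submodule.starProjection_apply_mem U _)
        (Submodule.starProjection_apply_mem Uᗮ _)
    rw [e, sq, norm_add_sq_eq_norm_sq_add_norm_sq_of_inner_eq_zero _ _ ho, ← sq, ← sq]
    have h1 : ‖U.starProjection (a v)‖ ≤ ‖a‖ :=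
      (Submodule.norm_starProjection_apply_le U _).trans (a.unit_le_opNorm v hv.le)
    have h2 : ‖Uᗮ.starProjection (b v)‖ ≤ ‖b‖ :=
      (Submodule.norm_starProjection_apply_le Uᗮ _).trans (b.unit_le_opNorm v hv.le)
    gcongr
  calc _ ≤ √(‖a‖ ^ 2 + ‖b‖ ^ 2) ^ 2 := by gcongr
    _ = _ := Real.sq_sqrt (by positivity)

/-- A norm-one functional on `K(H)` is concentrated, up to `2 / 3`, on a finite-dimensional
subspace. -/
theorem exists_norm_comp_leftMul_one_sub_le (hφ : ‖φ‖ = 1) :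
    ∃ (U : Submodule ℂ H) (_ : FiniteDimensional ℂ U),
      ‖φ.comp (leftMul (1 - U.starProjection))‖ ≤ 2 / 3 := by
  obtain ⟨a, ha1, ha⟩ : ∃ a : compactOps H, ‖a‖ ≤ 1 ∧ 7 / 8 < ‖φ a‖ := by
    obtain ⟨a, ha, h⟩ := φ.exists_lt_apply_of_lt_opNorm (r := 7 / 8) (by rw [hφ]; norm_num)
    exact ⟨a, ha.le, h⟩
  obtain ⟨U, hU, hUa⟩ := exists_norm_sub_starProjection_mul_le a (δ := 1 / 8) (by norm_num)
  refine ⟨U, hU, ContinuousLinearMap.opNorm_le_of_unit_norm (𝕜 := ℂ) (by norm_num) fun b hb => ?_⟩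
  have hPa : 3 / 4 < ‖φ (leftMul U.starProjection a)‖ := by
    have h1 : ‖φ (a - leftMul U.starProjection a)‖ ≤ 1 / 8 := by
      refine (φ.le_opNorm _).trans ?_
      rw [hφ, one_mul]
      exact hUa
    rw [map_sub] at h1
    linarith [norm_sub_norm_le (φ a) (φ (leftMul U.starProjection a))]
  obtain ⟨c, hc, hca⟩ := Complex.exists_norm_eq_mul_self (φ (leftMul U.starProjection a))
  obtain ⟨d, hd, hdb⟩ := Complex.exists_norm_eq_mul_self (φ (leftMul (1 - U.starProjection) b))
  -- The phases `c`, `d` make both values of `φ` add up. With weights 1 and 3/4, `‖w‖ ≤ √(1 + 9/16)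
  -- = 5/4`, so `3/4 + (3/4) t ≤ 5/4` for `t = ‖φ((1 - P) b)‖`, whence `t ≤ 2/3`.
  set w : compactOps H := leftMul U.starProjection (c • a)
    + leftMul (1 - U.starProjection) ((3 / 4 * d : ℂ) • b) with hw
  have hφw : φ w = ((‖φ (leftMul U.starProjection a)‖
      + 3 / 4 * ‖φ (leftMul (1 - U.starProjection) b)‖ : ℝ) : ℂ) := by
    rw [hw, map_add, map_smul, map_smul, map_smul, map_smul]
    push_cast
    rw [hca, hdb, smul_eq_mul, smul_eq_mul]
    ring
  have hwn : ‖w‖ ≤ 5 / 4 := by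
    have h := norm_starProjection_mul_add_sq_le U ((c • a : compactOps H) : H →L[ℂ] H)
      (((3 / 4 * d : ℂ) • b : compactOps H) : H →L[ℂ] H)
    have h1 : ‖((c • a : compactOps H) : H →L[ℂ] H)‖ ≤ 1 := by
      change ‖c • a‖ ≤ 1
      rw [norm_smul, hc, one_mul]
      exact ha1
    have h2 : ‖(((3 / 4 * d : ℂ) • b : compactOps H) : H →L[ℂ] H)‖ = 3 / 4 := by
      change ‖(3 / 4 * d : ℂ) • b‖ = 3 / 4
      rw [norm_smul, norm_mul, hd, hb]
      norm_num
    rw [h2] at h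
    change ‖w‖ ^ 2 ≤ _ at h
    refine le_of_sq_le_sq ?_ (by norm_num)
    nlinarith [norm_nonneg ((c • a : compactOps H) : H →L[ℂ] H)]
  have h := (φ.le_opNorm w).trans_eq (by rw [hφ, one_mul])
  rw [hφw, Complex.norm_real, Real.norm_of_nonneg (by positivity)] at h
  rw [ContinuousLinearMap.comp_apply]
  linarith

/-- For the projection `P` on which `φ` concentrates, the left functional has real part at least `1
- 2/3` at `P`, and the right one is nonnegative there. -/
theorem exists_quadForm_pos (hφ : ‖φ‖ = 1) (hz : ‖z‖ = 1) (hzφ : z φ = 1) :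
    ∃ x : compactOps H, ‖(x : H →L[ℂ] H)‖ ≤ 1 ∧ 0 < quadForm φ z x := by
  obtain ⟨U, hU, h⟩ := exists_norm_comp_leftMul_one_sub_le hφ
  refine ⟨proj U, U.starProjection_norm_le, ?_⟩
  have hP := isStarProjection_starProjection (U := U)
  have h1 : ‖leftFunctional φ z (1 - U.starProjection)‖ ≤ 2 / 3 := by
    refine (z.le_opNorm _).trans ?_
    rw [hz, one_mul]
    exact h
  rw [map_sub, leftFunctional_one hzφ] at h1
  have h2 := (Complex.re_le_norm _).trans h1
  have h3 := re_rightFunctional_star_mul_self_nonneg hφ hz hzφ U.starProjection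
  rw [quadForm_eq]
  change 0 < ((leftFunctional φ z (U.starProjection * star U.starProjection)).re
      + (rightFunctional φ z (star U.starProjection * U.starProjection)).re) / 2
  rw [hP.isSelfAdjoint.star_eq, hP.isIdempotentElem.eq] at h3 ⊢
  rw [Complex.sub_re, Complex.one_re] at h2
  linarith

/-! ### Rank-one operators and the lower bound for the ratio -/

theorem quadForm_rankOne (η : H) {ξ : H} (hη : ‖η‖ = 1) (hξ : ‖ξ‖ = 1) :
    quadForm φ z (rankOne η ξ) = ((leftFunctional φ z (InnerProductSpace.rankOne ℂ η η)).re
      + (rightFunctional φ z (InnerProductSpace.rankOne ℂ ξ ξ)).re) / 2 := by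
  rw [quadForm_eq]
  have h : ((rankOne η ξ : compactOps H) : H →L[ℂ] H) = InnerProductSpace.rankOne ℂ η ξ := rfl
  simp [h, ContinuousLinearMap.star_eq_adjoint, ContinuousLinearMap.mul_def,
    InnerProductSpace.rankOne_comp_rankOne, hη, hξ]

/-- Averaging over an orthonormal basis of a subspace of dimension `N` produces a unit vector
`η` for which `η ⊗ ξ` has a small seminorm. -/
theorem exists_quadForm_rankOne_le (hφ : ‖φ‖ = 1) (hz : ‖z‖ = 1) {ξ : H} (hξ : ‖ξ‖ = 1)
    (U : Submodule ℂ H) [FiniteDimensional ℂ U] (hU : 0 < Module.finrank ℂ U) :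
    ∃ η : H, ‖η‖ = 1 ∧
      quadForm φ z (rankOne η ξ) ≤ (1 + 1 / (Module.finrank ℂ U : ℝ)) / 2 := by
  set b := stdOrthonormalBasis ℂ U
  -- The rank-one projections of the basis add up to the projection onto `U`, which has norm at most
  -- 1.
  have hsum : ∑ i, (leftFunctional φ z (InnerProductSpace.rankOne ℂ (b i : H) (b i : H))).re
      ≤ 1 := by
    rw [← Complex.re_sum, ← map_sum, ← b.starProjection_eq_sum_rankOne]
    exact (Complex.re_le_norm _).trans
      ((norm_leftFunctional_le hφ hz _).trans U.starProjection_norm_le)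
  have hne : (Finset.univ : Finset (Fin (Module.finrank ℂ U))).Nonempty :=
    ⟨⟨0, hU⟩, Finset.mem_univ _⟩
  obtain ⟨i, -, hi⟩ := Finset.exists_le_of_sum_le hne
    (g := fun _ => 1 / (Module.finrank ℂ U : ℝ)) (hsum.trans_eq (by
      have : (Module.finrank ℂ U : ℝ) ≠ 0 := by positivity
      simp [this]))
  have hbi : ‖(b i : H)‖ = 1 := b.norm_eq_one i
  refine ⟨b i, hbi, ?_⟩
  have h2 := (Complex.re_le_norm _).trans
    (norm_rightFunctional_le hφ hz (InnerProductSpace.rankOne ℂ ξ ξ))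
  rw [InnerProductSpace.norm_rankOne, hξ, mul_one] at h2
  rw [quadForm_rankOne _ hbi hξ]
  linarith

theorem evalAt_apply (ξ : H) (x : compactOps H) : evalAt ξ x = (x : H →L[ℂ] H) ξ := rfl

theorem evalAt_rankOne (η : H) {ξ : H} (hξ : ‖ξ‖ = 1) : evalAt ξ (rankOne η ξ) = η := by
  rw [evalAt_apply]
  simp [rankOne, hξ]

theorem norm_evalAt {ξ : H} (hξ : ‖ξ‖ = 1) : ‖evalAt ξ‖ = 1 := by
  refine le_antisymm ?_ ?_
  · rw [← hξ]
    exact LinearMap.mkContinuous_norm_le _ (norm_nonneg ξ) _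
  · have h := (evalAt ξ).le_opNorm (rankOne ξ ξ)
    have h1 : ‖rankOne ξ ξ‖ = 1 := by
      change ‖InnerProductSpace.rankOne ℂ ξ ξ‖ = 1
      simp [hξ]
    rwa [evalAt_rankOne ξ hξ, h1, mul_one, hξ] at h

/-- A quotient with nonvanishing seminorm is a lower bound for the supremum. -/
theorem ofReal_le_ratioSup {ξ : H} (hξ : ‖ξ‖ = 1) {r : ℝ} (x : compactOps H)
    (hx : 0 < quadForm φ z x) (hr : r * quadForm φ z x ≤ ‖evalAt ξ x‖ ^ 2) :
    ENNReal.ofReal √r ≤ JBStarAlgebra.ratioSup (evalAt ξ) φ z := by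
  have hs : JBStarAlgebra.seminormAt φ z x = √(quadForm φ z x) := rfl
  have hpos := Real.sqrt_pos.2 hx
  refine le_trans (ENNReal.ofReal_le_ofReal ?_)
    (le_iSup₂_of_le x (by rw [hs]; exact hpos.ne') le_rfl)
  rw [norm_evalAt hξ, one_mul, hs, le_div_iff₀ hpos, ← Real.sqrt_mul' _ hx.le]
  exact Real.sqrt_le_iff.2 ⟨norm_nonneg _, hr⟩

/-- The test operator is `η ⊗ ξ` with `η` from the averaging argument, perturbed when its seminorm
vanishes. -/
theorem ofReal_sqrt_le_ratioSup_of_finrank (hφ : ‖φ‖ = 1)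
    (hz : JBStarAlgebra.IsNormingFor φ z) {ξ : H} (hξ : ‖ξ‖ = 1)
    (U : Submodule ℂ H) [FiniteDimensional ℂ U] (hU : 0 < Module.finrank ℂ U) :
    ENNReal.ofReal √(2 * Module.finrank ℂ U / (Module.finrank ℂ U + 1))
      ≤ JBStarAlgebra.ratioSup (evalAt ξ) φ z := by
  obtain ⟨hz1, hzφ⟩ := hz
  rw [hφ, Complex.ofReal_one] at hzφ
  obtain ⟨η, hη, hle⟩ := exists_quadForm_rankOne_le hφ hz1 hξ U hU
  have hN : (0 : ℝ) < Module.finrank ℂ U := by exact_mod_cast hU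
  set N : ℝ := (Module.finrank ℂ U : ℝ)
  have hN2 : 2 * N / (N + 1) ≤ 2 := by
    rw [div_le_iff₀ (by positivity)]
    linarith
  rcases (quadForm_nonneg hφ hz1 hzφ (rankOne η ξ)).eq_or_lt with h0 | h0
  -- Degenerate case: by the parallelogram law the form at `η ⊗ ξ ± y/4` sums to `2 · (1/16)` times
  -- its value at `y`. The sum is positive and at most 1/8, so one sign gives a positive value at
  -- most 1/8, while the image under `T_ξ` keeps norm at least 3/4. The bound follows from `2 ·
  -- (1/8) ≤ (3/4)²`.
  · obtain ⟨y, hy1, hy⟩ := exists_quadForm_pos hφ hz1 hzφ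
    have hpar := quadForm_add_add_quadForm_sub φ z (rankOne η ξ) (((1 / 4 : ℝ) : ℂ) • y)
    rw [← h0, quadForm_smul] at hpar
    have hy2 : quadForm φ z y ≤ 1 := (quadForm_le hφ hz1 y).trans (by
      nlinarith [norm_nonneg (y : H →L[ℂ] H)])
    have hp := quadForm_nonneg hφ hz1 hzφ (rankOne η ξ + ((1 / 4 : ℝ) : ℂ) • y)
    have hm := quadForm_nonneg hφ hz1 hzφ (rankOne η ξ - ((1 / 4 : ℝ) : ℂ) • y)
    have hyξ : ‖evalAt ξ (((1 / 4 : ℝ) : ℂ) • y)‖ ≤ 1 / 4 := by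
      have h1 : ‖evalAt ξ y‖ ≤ 1 := by
        refine ((evalAt ξ).le_opNorm y).trans ?_
        rw [norm_evalAt hξ, one_mul]
        exact hy1
      rw [map_smul, norm_smul, Complex.norm_real, Real.norm_of_nonneg (by norm_num)]
      linarith
    have key : ∀ x : compactOps H, 0 < quadForm φ z x → quadForm φ z x ≤ 1 / 8 →
        3 / 4 ≤ ‖evalAt ξ x‖ →
          ENNReal.ofReal √(2 * N / (N + 1)) ≤ JBStarAlgebra.ratioSup (evalAt ξ) φ z := by
      intro x hx hx8 hxξ
      refine ofReal_le_ratioSup hξ x hx ?_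
      calc 2 * N / (N + 1) * quadForm φ z x ≤ 2 * (1 / 8) := by gcongr
        _ ≤ (3 / 4) ^ 2 := by norm_num
        _ ≤ _ := by gcongr
    rcases hp.eq_or_lt with hp0 | hp0
    · refine key _ (by nlinarith) (by nlinarith) ?_
      rw [map_sub, evalAt_rankOne η hξ]
      linarith [norm_sub_norm_le η (evalAt ξ (((1 / 4 : ℝ) : ℂ) • y))]
    · refine key _ hp0 (by nlinarith) ?_
      rw [map_add, evalAt_rankOne η hξ]
      have := norm_sub_le (η + evalAt ξ (((1 / 4 : ℝ) : ℂ) • y)) (evalAt ξ (((1 / 4 : ℝ) : ℂ) • y))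
      rw [add_sub_cancel_right] at this
      linarith
  · refine ofReal_le_ratioSup hξ _ h0 ?_
    rw [evalAt_rankOne η hξ, hη]
    calc 2 * N / (N + 1) * quadForm φ z (rankOne η ξ)
        ≤ 2 * N / (N + 1) * ((1 + 1 / N) / 2) := by gcongr
      _ = 1 ^ 2 := by field_simp

end compactOps

end

/-! ### From ratios to constants -/

namespace JBStarAlgebra

open Filter Topology

/-- A lower bound for all the suprema of quotients of one operator is a lower bound for the constant
in the little Grothendieck inequality. -/
theorem LittleGrothendieck.le_of_forall_ratioSup {B : Type*} [NormedAddCommGroup B]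
    [NormedSpace ℂ B] [JBStarAlgebra B] {H : Type*} [NormedAddCommGroup H] [InnerProductSpace ℂ H]
    {K r : ℝ} (h : LittleGrothendieck B H K) (hr : 0 < r) (T : B →L[ℂ] H) (hT : ‖T‖ = 1)
    (hφ : ∀ φ z, ‖φ‖ = 1 → IsNormingFor φ z → ENNReal.ofReal r ≤ ratioSup T φ z) : r ≤ K := by
  refine le_of_forall_pos_le_add fun ε hε => ?_
  obtain ⟨φ, z, h1, hz, hx⟩ := h T ε hε
  have hsup : ratioSup T φ z ≤ ENNReal.ofReal (K + ε) := by
    refine iSup₂_le fun x hx0 => ENNReal.ofReal_le_ofReal ?_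
    have hpos : 0 < seminormAt φ z x := lt_of_le_of_ne (Real.sqrt_nonneg _) hx0.symm
    have := hx x
    rw [hT, mul_one] at this
    rwa [hT, one_mul, div_le_iff₀ hpos]
  -- `K + ε` is not known to be nonnegative; `r > 0` excludes the case where `ENNReal.ofReal`
  -- truncates.
  exact ((ENNReal.ofReal_le_ofReal_iff' ).1 ((hφ φ z h1 hz).trans hsup)).resolve_right hr.not_ge

variable {H : Type*} [NormedAddCommGroup H] [InnerProductSpace ℂ H] [CompleteSpace H]

/-- `H` has subspaces of every finite dimension `n`, and `2n/(n+1) → 2`. -/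
theorem ofReal_sqrt_two_le_ratioSup (hH : ¬ FiniteDimensional ℂ H) {ξ : H} (hξ : ‖ξ‖ = 1)
    {φ : StrongDual ℂ (compactOps H)} {z : StrongDual ℂ (StrongDual ℂ (compactOps H))}
    (hφ : ‖φ‖ = 1) (hz : IsNormingFor φ z) :
    ENNReal.ofReal √2 ≤ ratioSup (evalAt ξ) φ z := by
  have hlim : Tendsto (fun n : ℕ => ENNReal.ofReal √(2 * ((n : ℝ) / (n + 1)))) atTop
      (𝓝 (ENNReal.ofReal √2)) := by
    have h := (tendsto_natCast_div_add_atTop (1 : ℝ)).const_mul 2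
    rw [mul_one] at h
    exact ENNReal.tendsto_ofReal ((Real.continuous_sqrt.tendsto 2).comp h)
  refine le_of_tendsto hlim ((eventually_gt_atTop 0).mono fun n hn => ?_)
  obtain ⟨v, hv⟩ := Module.le_rank_iff_exists_linearMap (R := ℂ) (M := H) (n := n) |>.1
    ((Cardinal.natCast_le_aleph0).trans (not_lt.1 fun h => hH (Module.rank_lt_aleph0_iff.1 h)))
  have hfr : Module.finrank ℂ (LinearMap.range v) = n := by
    rw [LinearMap.finrank_range_of_inj hv, Module.finrank_fin_fun]
  have h := compactOps.ofReal_sqrt_le_ratioSup_of_finrank hφ hz hξ (LinearMap.range v)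
    (by rwa [hfr])
  rwa [hfr, mul_div_assoc] at h

/-- Taking the whole space as the subspace gives `2n/(n+1)`, which already exceeds `2n/(n+2)`. -/
theorem ofReal_sqrt_le_ratioSup_of_finrank_eq {n : ℕ} (hn : 1 ≤ n) (hH : Module.finrank ℂ H = n)
    {ξ : H} (hξ : ‖ξ‖ = 1)
    {φ : StrongDual ℂ (compactOps H)} {z : StrongDual ℂ (StrongDual ℂ (compactOps H))}
    (hφ : ‖φ‖ = 1) (hz : IsNormingFor φ z) :
    ENNReal.ofReal √(2 * n / (n + 2)) ≤ ratioSup (evalAt ξ) φ z := by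
  have : FiniteDimensional ℂ H := FiniteDimensional.of_finrank_pos (by omega)
  have hfr : Module.finrank ℂ (⊤ : Submodule ℂ H) = n := by rw [finrank_top, hH]
  have h := compactOps.ofReal_sqrt_le_ratioSup_of_finrank hφ hz hξ ⊤ (by omega)
  rw [hfr] at h
  refine le_trans (ENNReal.ofReal_le_ofReal (Real.sqrt_le_sqrt ?_)) h
  gcongr
  norm_num

theorem LittleGrothendieck.sqrt_two_le (hH : ¬ FiniteDimensional ℂ H) {K : ℝ}
    (h : LittleGrothendieck (compactOps H) H K) : √2 ≤ K := by
  have : Nontrivial H := by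
    by_contra hn
    rw [not_nontrivial_iff_subsingleton] at hn
    exact hH inferInstance
  obtain ⟨ξ, hξ⟩ := exists_norm_eq H zero_le_one
  exact h.le_of_forall_ratioSup (by positivity) (evalAt ξ) (compactOps.norm_evalAt hξ)
    fun φ z hφ hz => ofReal_sqrt_two_le_ratioSup hH hξ hφ hz

theorem not_finiteDimensional_lp (ι : Type*) [Infinite ι] :
    ¬ FiniteDimensional ℂ (lp (fun _ : ι => ℂ) 2) := by
  intro h
  have hb : HilbertBasis ι ℂ (lp (fun _ : ι => ℂ) 2) := HilbertBasis.ofRepr (.refl ℂ _)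
  exact Infinite.not_finite hb.orthonormal.linearIndependent.finite

end JBStarAlgebra

open JBStarAlgebra in
theorem mainTheorem9 :
    -- infinite-dimensional Hilbert spaces
    (∀ (H : Type u) [NormedAddCommGroup H] [InnerProductSpace ℂ H] [CompleteSpace H],
      ¬ FiniteDimensional ℂ H →
        (∀ ξ : H, ‖ξ‖ = 1 →
          ‖evalAt ξ‖ = 1 ∧
          ∀ (φ : StrongDual ℂ (compactOps H)) (z : StrongDual ℂ (StrongDual ℂ (compactOps H))),
            ‖φ‖ = 1 → IsNormingFor φ z →
              ENNReal.ofReal (Real.sqrt 2) ≤ ratioSup (evalAt ξ) φ z) ∧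
        ∀ K : ℝ, LittleGrothendieck (compactOps H) H K → Real.sqrt 2 ≤ K) ∧
    -- the constant in the little Grothendieck theorem for JB*-algebras
    (∀ K : ℝ, IsLittleGrothendieckConstant.{u} K → Real.sqrt 2 ≤ K) ∧
    -- Hilbert spaces of finite dimension `n ≥ 1`
    (∀ (n : ℕ) (H : Type u) [NormedAddCommGroup H] [InnerProductSpace ℂ H] [CompleteSpace H],
      1 ≤ n → Module.finrank ℂ H = n →
        (∀ ξ : H, ‖ξ‖ = 1 →
          ‖evalAt ξ‖ = 1 ∧
          ∀ (φ : StrongDual ℂ (compactOps H)) (z : StrongDual ℂ (StrongDual ℂ (compactOps H))),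
            ‖φ‖ = 1 → IsNormingFor φ z →
              ENNReal.ofReal (Real.sqrt (2 * n / (n + 2))) ≤ ratioSup (evalAt ξ) φ z) ∧
        ∀ K : ℝ, LittleGrothendieck (compactOps H) H K →
          Real.sqrt (2 * n / (n + 2)) ≤ K) := by
  refine ⟨fun H _ _ _ hH => ⟨fun ξ hξ => ⟨compactOps.norm_evalAt hξ, fun φ z hφ hz =>
    ofReal_sqrt_two_le_ratioSup hH hξ hφ hz⟩, fun K hK => hK.sqrt_two_le hH⟩, fun K hK => ?_,
    fun n H _ _ _ hn hH => ⟨fun ξ hξ => ⟨compactOps.norm_evalAt hξ, fun φ z hφ hz =>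
      ofReal_sqrt_le_ratioSup_of_finrank_eq hn hH hξ hφ hz⟩, fun K hK => ?_⟩⟩
  -- Any infinite-dimensional Hilbert space in `Type u` suffices; `ULift` places `ℓ²` in that
  -- universe.
  · have hH := not_finiteDimensional_lp (ULift.{u} ℕ)
    have : Nontrivial (lp (fun _ : ULift.{u} ℕ => ℂ) 2) := by
      by_contra hn
      rw [not_nontrivial_iff_subsingleton] at hn
      exact hH inferInstance
    obtain ⟨ξ, hξ⟩ := exists_norm_eq (lp (fun _ : ULift.{u} ℕ => ℂ) 2) zero_le_one
    have : Nontrivial (compactOps (lp (fun _ : ULift.{u} ℕ => ℂ) 2)) := by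
      refine nontrivial_of_ne (compactOps.rankOne ξ ξ) 0 fun h => ?_
      have h1 := compactOps.evalAt_rankOne ξ hξ
      rw [h, map_zero] at h1
      rw [← h1, norm_zero] at hξ
      exact zero_ne_one hξ
    exact (hK (compactOps (lp (fun _ : ULift.{u} ℕ => ℂ) 2))
      (lp (fun _ : ULift.{u} ℕ => ℂ) 2)).sqrt_two_le hH
  · have : Nontrivial H := Module.nontrivial_of_finrank_pos (R := ℂ) (by omega)
    obtain ⟨ξ, hξ⟩ := exists_norm_eq H zero_le_one
    have hn' : (0 : ℝ) < n := by exact_mod_cast hn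
    exact hK.le_of_forall_ratioSup (by positivity) (evalAt ξ) (compactOps.norm_evalAt hξ)
      fun φ z hφ hz => ofReal_sqrt_le_ratioSup_of_finrank_eq hn hH hξ hφ hz
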